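/- Let $(Z,d)$ be a locally compact, complete, separable, geodesic metric space (any two points $x,y\in Z$ are joined by an isometric image of the interval $[0,d(x,y)]$), and let $e\in Z$ be a base point. Let $\mathcal M(Z)$ be the space of finite signed Borel measures on $Z$, let $|\mu|$ denote the total variation measure of $\mu\in\mathcal M(Z)$, and let $\mathcal M_1(Z)=\{\mu\in\mathcal M(Z):\int_Z d(z,e)\,\mathrm d|\mu|(z)<\infty\}$. On $\mathcal M_1(Z)$ consider the (unbalanced Kantorovich–Rubinstein) norm \[ \|\mu\|_{\mathrm{KRu}}:=|\mu(Z)|+\sup\Big\{\int_Z f\,\mathrm d\mu \;:\; f:Z\to\mathbb R,\ f(e)=0,\ |f(z)-f(z')|\le d(z,z')\ \text{for all } z,z'\in Z\Big\}, \] and let $\mathrm{KRu}(Z)$ be the completion of $\mathcal M_1(Z)$ with respect to $\|\cdot\|_{\mathrm{KRu}}$. Then for every real $p>1$ the set \[ B^p=\Big\{\mu\in\mathcal M(Z):\int_Z\big(1+d(z,e)^p\big)\,\mathrm d|\mu|(z)\le 1\Big\} \] is contained in $\mathcal M_1(Z)$ and is compact in $\mathrm{KRu}(Z)$ for the topology of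 the norm $\|\cdot\|_{\mathrm{KRu}}$. -/

import Mathlib

open MeasureTheory Set
open scoped ENNReal NNReal

noncomputable section

namespace KantorovichRubinstein

/-- A metric space is geodesic if any two points `x`, `y` are joined by a curve of length
`dist x y`, that is (after parametrisation by arc length) by an isometric image of the interval
`[0, dist x y]`. -/
def IsGeodesicSpace (Z : Type*) [MetricSpace Z] : Prop :=
  ∀ x y : Z, ∃ γ : ℝ → Z, γ 0 = x ∧ γ (dist x y) = y ∧
    ∀ s ∈ Icc (0 : ℝ) (dist x y), ∀ t ∈ Icc (0 : ℝ) (dist x y), dist (γ s) (γ t) = |s - t|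

/-- The variation of a (real-valued) signed measure is finite. -/
instance isFiniteMeasure_variation {Z : Type*} [MeasurableSpace Z] (μ : SignedMeasure Z) :
    IsFiniteMeasure μ.variation := by
  rw [← SignedMeasure.totalVariation_eq_variation]
  unfold SignedMeasure.totalVariation
  infer_instance

variable {Z : Type*} [MetricSpace Z] [MeasurableSpace Z]

/-- The space `𝓜_q(Z)` of finite signed Borel measures `μ` with `∫ d(z, e)^q d|μ|(z) < ∞`. -/
def momentMeasures (e : Z) (q : ℝ) : Submodule ℝ (SignedMeasure Z) where
  carrier := {μ | ∫⁻ z, ENNReal.ofReal (dist z e ^ q) ∂μ.variation < ∞}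
  zero_mem' := by simp
  add_mem' := by
    intro μ ν hμ hν
    calc ∫⁻ z, ENNReal.ofReal (dist z e ^ q) ∂(μ + ν).variation
        ≤ ∫⁻ z, ENNReal.ofReal (dist z e ^ q) ∂(μ.variation + ν.variation) :=
          lintegral_mono' VectorMeasure.variation_add_le le_rfl
      _ < ∞ := by
          rw [lintegral_add_measure]
          exact ENNReal.add_lt_top.2 ⟨hμ, hν⟩
  smul_mem' := by
    intro c μ hμ
    simp only [mem_ofPred_eq, VectorMeasure.variation_smul, lintegral_smul_measure] at hμ ⊢
    exact ENNReal.mul_lt_top (by simp) hμ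

/-- The underlying vector space of the normed space `(𝓜_1(Z), ‖·‖_KRu)`. -/
def M1 (e : Z) : Type _ := momentMeasures e 1

instance (e : Z) : AddCommGroup (M1 e) := inferInstanceAs (AddCommGroup (momentMeasures e 1))

instance (e : Z) : Module ℝ (M1 e) := inferInstanceAs (Module ℝ (momentMeasures e 1))

/-- The measure underlying an element of `𝓜_1(Z)`. -/
def M1.toSigned {e : Z} : M1 e →ₗ[ℝ] SignedMeasure Z := (momentMeasures e 1).subtype

theorem M1.toSigned_injective {e : Z} : Function.Injective (M1.toSigned (e := e)) :=
  Subtype.val_injective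

/-- The functions `f` with `f(e) = 0` and Lipschitz constant `L(f) ≤ 1`. -/
def lipUnitBall {Z : Type*} [MetricSpace Z] (e : Z) : Set (Z → ℝ) :=
  {f | f e = 0 ∧ LipschitzWith 1 f}

theorem zero_mem_lipUnitBall {Z : Type*} [MetricSpace Z] {e : Z} :
    (fun _ => 0 : Z → ℝ) ∈ lipUnitBall e :=
  ⟨rfl, LipschitzWith.const' (0 : ℝ)⟩

/-- `‖μ‖_KRu = |μ(Z)| + sup {∫ f dμ : f(e) = 0, L(f) ≤ 1}`. -/
def normKRu (e : Z) (μ : SignedMeasure Z) : ℝ :=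
  |μ univ| + sSup ((fun f : Z → ℝ => ∫ᵛ z, f z ∂•μ) '' lipUnitBall e)

/-- The set `B^p` of finite signed measures `μ` with `∫ (1 + d(z, e)^p) d|μ|(z) ≤ 1`. -/
def momentBall (e : Z) (p : ℝ) : Set (SignedMeasure Z) :=
  {μ | ∫⁻ z, ENNReal.ofReal (1 + dist z e ^ p) ∂μ.variation ≤ 1}

instance (e : Z) : Norm (M1 e) := ⟨fun μ => normKRu e μ.toSigned⟩

theorem M1.norm_def {e : Z} (μ : M1 e) : ‖μ‖ = normKRu e μ.toSigned := rfl

section norm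

variable [BorelSpace Z] {e : Z}

theorem integrable_lip (μ : M1 e) {f : Z → ℝ} {K : ℝ≥0} (hf : LipschitzWith K f) :
    μ.toSigned.Integrable f := by
  have hμ : ∫⁻ z, ENNReal.ofReal (dist z e ^ (1 : ℝ)) ∂μ.toSigned.variation < ∞ := μ.2
  have hd : Integrable (fun z => dist z e) μ.toSigned.variation := by
    refine ⟨(LipschitzWith.dist_left e).continuous.measurable.aestronglyMeasurable, ?_⟩
    rw [hasFiniteIntegral_iff_ofReal (Filter.Eventually.of_forall fun _ => dist_nonneg)]
    simpa using hμ
  refine Integrable.mono' ((integrable_const |f e|).add (hd.const_mul K))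
    hf.continuous.measurable.aestronglyMeasurable (Filter.Eventually.of_forall fun z => ?_)
  have h1 := hf.dist_le_mul z e
  rw [Real.dist_eq] at h1
  have h2 := abs_sub_abs_le_abs_sub (f z) (f e)
  simp only [Pi.add_apply, Real.norm_eq_abs]
  linarith

theorem bddAbove_integral (μ : M1 e) :
    BddAbove ((fun f : Z → ℝ => ∫ᵛ z, f z ∂•μ.toSigned) '' lipUnitBall e) := by
  refine ⟨‖(ContinuousLinearMap.lsmul ℝ ℝ : ℝ →L[ℝ] ℝ →L[ℝ] ℝ)‖ *
    ∫ z, dist z e ∂μ.toSigned.variation, ?_⟩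
  rintro _ ⟨f, ⟨hf0, hf⟩, rfl⟩
  have h : ‖∫ᵛ z, f z ∂•μ.toSigned‖ ≤ _ := VectorMeasure.norm_integral_le_integral_norm
  refine (le_abs_self _).trans (h.trans ?_)
  gcongr
  · exact (integrable_lip μ hf).norm
  · exact integrable_lip μ (LipschitzWith.dist_left e)
  · intro z
    simpa [Real.dist_eq, hf0] using hf.dist_le_mul z e

theorem integral_le_sSup (μ : M1 e) {f : Z → ℝ} (hf : f ∈ lipUnitBall e) :
    ∫ᵛ z, f z ∂•μ.toSigned ≤ sSup ((fun f : Z → ℝ => ∫ᵛ z, f z ∂•μ.toSigned) '' lipUnitBall e) :=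
  le_csSup (bddAbove_integral μ) ⟨f, hf, rfl⟩

theorem sSup_integral_nonneg (μ : M1 e) :
    0 ≤ sSup ((fun f : Z → ℝ => ∫ᵛ z, f z ∂•μ.toSigned) '' lipUnitBall e) := by
  simpa using integral_le_sSup μ zero_mem_lipUnitBall

theorem abs_integral_le_sSup (μ : M1 e) {f : Z → ℝ} (hf : f ∈ lipUnitBall e) :
    |∫ᵛ z, f z ∂•μ.toSigned| ≤
      sSup ((fun f : Z → ℝ => ∫ᵛ z, f z ∂•μ.toSigned) '' lipUnitBall e) := by
  refine abs_le.2 ⟨?_, integral_le_sSup μ hf⟩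
  have h := integral_le_sSup μ (f := -f) ⟨by simp [hf.1], hf.2.neg⟩
  have h2 : ∫ᵛ z, (-f) z ∂•μ.toSigned = -∫ᵛ z, f z ∂•μ.toSigned :=
    VectorMeasure.integral_neg _ _ _
  linarith

theorem normKRu_add_le (μ ν : M1 e) :
    normKRu e (μ + ν).toSigned ≤ normKRu e μ.toSigned + normKRu e ν.toSigned := by
  have h1 : |(μ + ν).toSigned univ| ≤ |μ.toSigned univ| + |ν.toSigned univ| := by
    rw [map_add]
    exact abs_add_le _ _
  have h2 : sSup ((fun f : Z → ℝ => ∫ᵛ z, f z ∂•(μ + ν).toSigned) '' lipUnitBall e) ≤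
      sSup ((fun f : Z → ℝ => ∫ᵛ z, f z ∂•μ.toSigned) '' lipUnitBall e) +
      sSup ((fun f : Z → ℝ => ∫ᵛ z, f z ∂•ν.toSigned) '' lipUnitBall e) := by
    refine csSup_le ⟨_, _, zero_mem_lipUnitBall, rfl⟩ ?_
    rintro _ ⟨f, hf, rfl⟩
    simp only [map_add]
    rw [VectorMeasure.integral_add_vectorMeasure (integrable_lip μ hf.2) (integrable_lip ν hf.2)]
    exact add_le_add (integral_le_sSup μ hf) (integral_le_sSup ν hf)
  unfold normKRu
  linarith

theorem normKRu_smul_le (c : ℝ) (μ : M1 e) :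
    normKRu e (c • μ).toSigned ≤ |c| * normKRu e μ.toSigned := by
  have h1 : |(c • μ).toSigned univ| = |c| * |μ.toSigned univ| := by
    rw [map_smul]
    exact abs_mul _ _
  have h2 : sSup ((fun f : Z → ℝ => ∫ᵛ z, f z ∂•(c • μ).toSigned) '' lipUnitBall e) ≤
      |c| * sSup ((fun f : Z → ℝ => ∫ᵛ z, f z ∂•μ.toSigned) '' lipUnitBall e) := by
    refine csSup_le ⟨_, _, zero_mem_lipUnitBall, rfl⟩ ?_
    rintro _ ⟨f, hf, rfl⟩
    simp only [map_smul]
    rw [VectorMeasure.integral_smul_vectorMeasure, smul_eq_mul]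
    refine (le_abs_self _).trans ?_
    rw [abs_mul]
    exact mul_le_mul_of_nonneg_left (abs_integral_le_sSup μ hf) (abs_nonneg c)
  unfold normKRu
  linarith

theorem normKRu_smul (c : ℝ) (μ : M1 e) :
    normKRu e (c • μ).toSigned = |c| * normKRu e μ.toSigned := by
  refine le_antisymm (normKRu_smul_le c μ) ?_
  rcases eq_or_ne c 0 with rfl | hc
  · have h := sSup_integral_nonneg ((0 : ℝ) • μ)
    simp only [abs_zero, zero_mul]
    exact add_nonneg (abs_nonneg _) h
  · have h := normKRu_smul_le c⁻¹ (c • μ)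
    rw [smul_smul, inv_mul_cancel₀ hc, one_smul, abs_inv] at h
    have hc' : 0 < |c| := abs_pos.2 hc
    calc |c| * normKRu e μ.toSigned
        ≤ |c| * (|c|⁻¹ * normKRu e (c • μ).toSigned) := by gcongr
      _ = normKRu e (c • μ).toSigned := by field_simp

theorem eq_zero_of_normKRu_eq_zero (μ : M1 e) (h : normKRu e μ.toSigned = 0) : μ = 0 := by
  have h0 : μ.toSigned univ = 0 := by
    have := sSup_integral_nonneg μ
    have h2 := abs_nonneg (μ.toSigned univ)
    unfold normKRu at h
    exact abs_eq_zero.1 (by linarith)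
  have hS : sSup ((fun f : Z → ℝ => ∫ᵛ z, f z ∂•μ.toSigned) '' lipUnitBall e) = 0 := by
    unfold normKRu at h
    simpa [h0] using h
  -- integrals of all Lipschitz functions vanish
  have hI : ∀ (K : ℝ≥0) (f : Z → ℝ), LipschitzWith K f → ∫ᵛ z, f z ∂•μ.toSigned = 0 := by
    intro K f hf
    set c : ℝ := (K + 1 : ℝ)⁻¹
    have hK : (0 : ℝ) < K + 1 := by positivity
    have hg : (c • (f - fun _ => f e)) ∈ lipUnitBall e := by
      refine ⟨by simp, LipschitzWith.of_dist_le_mul fun x y => ?_⟩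
      have := hf.dist_le_mul x y
      simp only [Pi.smul_apply, Pi.sub_apply, smul_eq_mul, Real.dist_eq, NNReal.coe_one, one_mul]
        at this ⊢
      rw [← mul_sub, sub_sub_sub_cancel_right, abs_mul, abs_of_pos (by positivity),
        inv_mul_le_iff₀ hK]
      nlinarith [dist_nonneg (x := x) (y := y)]
    have h1 := abs_integral_le_sSup μ hg
    rw [hS] at h1
    have h2 := abs_eq_zero.1 (le_antisymm h1 (abs_nonneg _))
    have h3 : ∫ᵛ z, (c • (f - fun _ => f e) : Z → ℝ) z ∂•μ.toSigned
        = c • (∫ᵛ z, f z ∂•μ.toSigned - ∫ᵛ _, f e ∂•μ.toSigned) := by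
      rw [← VectorMeasure.integral_fun_sub (integrable_lip μ hf) (integrable_const _)]
      exact VectorMeasure.integral_smul _ _ _ c
    rw [h3, VectorMeasure.integral_const] at h2
    simpa [h0, hK.ne', c] using h2
  -- hence the measure vanishes on closed sets
  have hF : ∀ F : Set Z, IsClosed F → μ.toSigned F = 0 := by
    intro F hF
    have hδ : ∀ n : ℕ, 0 < 1 / ((n : ℝ) + 1) := fun n => by positivity
    have hlim : Filter.Tendsto
        (fun n : ℕ => ∫ᵛ z, ((thickenedIndicator (hδ n) F z : ℝ≥0) : ℝ) ∂•μ.toSigned)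
        Filter.atTop (nhds (∫ᵛ z, F.indicator (fun _ => (1 : ℝ)) z ∂•μ.toSigned)) := by
      refine VectorMeasure.tendsto_integral_of_dominated_convergence (fun _ => 1)
        (fun n => (NNReal.continuous_coe.comp
          (thickenedIndicator (hδ n) F).continuous).measurable.aestronglyMeasurable)
        (integrable_const _)
        (fun n => Filter.Eventually.of_forall fun z => ?_)
        (Filter.Eventually.of_forall fun z => ?_)
      · simpa using thickenedIndicator_le_one (hδ n) F z
      · have := thickenedIndicator_tendsto_indicator_closure hδ
          tendsto_one_div_add_atTop_nhds_zero_nat F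
        rw [tendsto_pi_nhds] at this
        have h := (NNReal.continuous_coe.tendsto _).comp (this z)
        rw [hF.closure_eq] at h
        have hz : F.indicator (fun _ => (1 : ℝ)) z
            = ((F.indicator (fun _ => (1 : ℝ≥0)) z : ℝ≥0) : ℝ) := by
          by_cases hz : z ∈ F <;> simp [hz]
        rw [hz]
        exact h
    rw [VectorMeasure.integral_indicator_const _ hF.measurableSet] at hlim
    have hz : ∀ n : ℕ, ∫ᵛ z, ((thickenedIndicator (hδ n) F z : ℝ≥0) : ℝ) ∂•μ.toSigned = 0 := by
      intro n
      refine hI ((1 / ((n : ℝ) + 1)).toNNReal⁻¹) _ ?_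
      exact (lipschitzWith_thickenedIndicator (hδ n) F)
    simp only [hz] at hlim
    simpa using (tendsto_nhds_unique hlim tendsto_const_nhds)
  apply M1.toSigned_injective
  rw [map_zero]
  refine VectorMeasure.ext_of_generateFrom _ (fun F hF' => by simpa using hF F hF')
    (BorelSpace.measurable_eq.trans borel_eq_generateFrom_isClosed) isPiSystem_isClosed ?_
  simpa using h0

theorem normedSpaceCore_M1 : NormedSpace.Core ℝ (M1 e) where
  norm_nonneg μ := add_nonneg (abs_nonneg _) (sSup_integral_nonneg μ)
  norm_smul c μ := normKRu_smul c μ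
  norm_triangle μ ν := normKRu_add_le μ ν
  norm_eq_zero_iff μ := by
    refine ⟨eq_zero_of_normKRu_eq_zero μ, ?_⟩
    rintro rfl
    rw [M1.norm_def]
    simpa using normKRu_smul (0 : ℝ) (0 : M1 e)

instance : NormedAddCommGroup (M1 e) := NormedAddCommGroup.ofCore normedSpaceCore_M1

instance : NormedSpace ℝ (M1 e) := NormedSpace.ofCore normedSpaceCore_M1

end norm

/-- `KRu(Z)`: the Banach space completion of `(𝓜_1(Z), ‖·‖_KRu)`. -/
abbrev KRu [BorelSpace Z] (e : Z) : Type _ := UniformSpace.Completion (M1 e)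

end KantorovichRubinstein

end

/-!
The moment ball `B^p` is compact because it is a continuous image of a weakly compact set of pairs
of positive measures.

By the Hopf–Rinow theorem (`IsGeodesicSpace.properSpace`), closed balls in `Z` are compact. The
pairs `(ν₁, ν₂)` of positive finite measures with `∫ (1 + d(z, e)^p) d(ν₁ + ν₂) ≤ 1` form a weakly
closed set, by lower semicontinuity of the moment, and both components are tight by Markov's
inequality, so that Prokhorov's theorem makes this set weakly compact (`isCompact_momentPairs`).
By the Jordan decomposition and the inequality `|ν₁ - ν₂| ≤ ν₁ + ν₂`, its image under
`(ν₁, ν₂) ↦ ν₁ - ν₂` is exactly `B^p` (`momentPairs.range_diff`).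

It remains to see that this map is continuous from the weak topology to the norm
(`momentPairs.continuous_diff`). For `η > 0`, a partition of unity on a large compact ball gives
finitely many points `x i` and bounded continuous `g i` with
`|f z - ∑ i, f (x i) * g i z| ≤ η * (1 + d(z, e)^p)` for all admissible `f` at once
(`exists_finite_approx`); this is where `p > 1` enters, since `d(z, e)^p` has to dominate
`|f z| ≤ d(z, e)` with a small constant far from `e`. Integrating against elements of `B^p`, the
supremum in the norm is controlled up to `2 * η` by the integrals of the finitely many `g i`
(`exists_norm_sub_le`), and these are weakly continuous.
-/

open Filter Topology Metric BoundedContinuousFunction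

namespace KantorovichRubinstein

/-! ### Complete, locally compact geodesic spaces are proper -/

theorem IsGeodesicSpace.closedBall_subset_cthickening {Z : Type*} [MetricSpace Z]
    (hZ : IsGeodesicSpace Z) (e : Z) {r s δ : ℝ} (hr : 0 ≤ r) (hs : s ≤ r + δ) :
    closedBall e s ⊆ cthickening δ (closedBall e r) := by
  intro x hx
  rw [mem_closedBall, dist_comm] at hx
  rcases le_total (dist e x) r with h | h
  · exact self_subset_cthickening _ (by rwa [mem_closedBall, dist_comm])
  obtain ⟨γ, h0, h1, hγ⟩ := hZ e x
  have hr' : r ∈ Icc 0 (dist e x) := ⟨hr, h⟩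
  refine mem_cthickening_of_dist_le x (γ r) δ _ ?_ ?_
  · rw [mem_closedBall, dist_comm, ← h0, hγ 0 ⟨le_rfl, hr.trans h⟩ r hr', zero_sub, abs_neg,
      abs_of_nonneg hr]
  · rw [← h1, hγ _ ⟨hr.trans h, le_rfl⟩ r hr', abs_of_nonneg (sub_nonneg.2 h)]
    linarith

/-- The radii of compact closed balls around `e` form an interval which is open (local
compactness) and closed (completeness) in `[0, ∞)`. -/
theorem IsGeodesicSpace.isCompact_closedBall {Z : Type*} [MetricSpace Z] [LocallyCompactSpace Z]
    [CompleteSpace Z] (hZ : IsGeodesicSpace Z) (e : Z) (R : ℝ) : IsCompact (closedBall e R) := by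
  by_contra hR
  set A : Set ℝ := {r | 0 ≤ r ∧ IsCompact (closedBall e r)}
  have hmono : ∀ r s, r ≤ s → IsCompact (closedBall e s) → IsCompact (closedBall e r) :=
    fun r s h hs => hs.of_isClosed_subset isClosed_closedBall (closedBall_subset_closedBall h)
  have h0 : (0 : ℝ) ∈ A := ⟨le_rfl, by simp⟩
  have hbdd : BddAbove A := by
    refine ⟨R, fun r hr => ?_⟩
    by_contra! h
    exact hR (hmono _ _ h.le hr.2)
  set s := sSup A
  have hs0 : 0 ≤ s := le_csSup hbdd h0
  have hlt : ∀ r < s, IsCompact (closedBall e r) := by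
    intro r hr
    obtain ⟨t, ht, hrt⟩ := exists_lt_of_lt_csSup ⟨0, h0⟩ hr
    exact hmono _ _ hrt.le ht.2
  have hs : IsCompact (closedBall e s) := by
    rcases hs0.eq_or_lt with h | h
    · rw [← h]
      exact h0.2
    refine isCompact_iff_totallyBounded_isComplete.2 ⟨?_, isClosed_closedBall.isComplete⟩
    rw [Metric.totallyBounded_iff]
    intro ε hε
    -- an `ε / 3`-net of the compact ball of radius `s - δ` is an `ε`-net of the ball of radius `s`
    set δ := min (ε / 3) s
    have hδ : 0 < δ := lt_min (by linarith) h
    have hδε : δ ≤ ε / 3 := min_le_left _ _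
    obtain ⟨t, ht, hcov⟩ := Metric.totallyBounded_iff.1
      (hlt (s - δ) (by linarith)).totallyBounded (ε / 3) (by linarith)
    refine ⟨t, ht, fun x hx => ?_⟩
    have hx' := hZ.closedBall_subset_cthickening e (sub_nonneg.2 (min_le_right _ _))
      (sub_add_cancel s δ).ge hx
    have hx'' := cthickening_subset_thickening' (δ₁ := δ) (δ₂ := 2 * ε / 3) (by linarith)
      (by linarith) _ hx'
    obtain ⟨y, hy, hxy⟩ := mem_thickening_iff.1 hx''
    obtain ⟨z, hz, hyz⟩ := mem_iUnion₂.1 (hcov hy)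
    refine mem_iUnion₂.2 ⟨z, hz, ?_⟩
    rw [mem_ball] at hyz ⊢
    linarith [dist_triangle x y z]
  obtain ⟨δ, hδ, hc⟩ := hs.exists_isCompact_cthickening
  have : s + δ ∈ A := ⟨by linarith, hc.of_isClosed_subset isClosed_closedBall
    (hZ.closedBall_subset_cthickening e hs0 le_rfl)⟩
  linarith [le_csSup hbdd this]

/-- The **Hopf–Rinow theorem** for geodesic spaces. -/
theorem IsGeodesicSpace.properSpace {Z : Type*} [MetricSpace Z] [LocallyCompactSpace Z]
    [CompleteSpace Z] (hZ : IsGeodesicSpace Z) : ProperSpace Z :=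
  ⟨hZ.isCompact_closedBall⟩

/-! ### Uniform approximation of Lipschitz functions by finitely many bounded functions -/

/-- All `f` with `f e = 0` and Lipschitz constant at most `1` are simultaneously approximated, up
to `η (1 + dist z e ^ p)`, by combinations of the same finitely many bounded continuous functions.
The `g i` are a partition of unity on a large ball, subordinate to a cover by balls of radius `η`
around the `x i`; outside the large ball the superlinear growth of `dist z e ^ p` absorbs `|f|`. -/
theorem exists_finite_approx {Z : Type*} [MetricSpace Z] [ProperSpace Z] (e : Z) {p : ℝ}
    (hp : 1 < p) {η : ℝ} (hη : 0 < η) :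
    ∃ (n : ℕ) (x : Fin n → Z) (g : Fin n → Z →ᵇ ℝ), ∀ f ∈ lipUnitBall e, ∀ z,
      |f z - ∑ i, f (x i) * g i z| ≤ η * (1 + dist z e ^ p) := by
  obtain ⟨R, hR0, hR⟩ : ∃ R : ℝ, 0 < R ∧ ∀ r, R < r → r ≤ η * r ^ p := by
    have h := (tendsto_rpow_atTop (sub_pos.2 hp)).eventually_ge_atTop (η⁻¹)
    obtain ⟨R, hR⟩ := eventually_atTop.1 h
    refine ⟨max R 1, by positivity, fun r hr => ?_⟩
    have hr0 : 0 < r := lt_trans (by positivity) hr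
    have h1 := hR r ((le_max_left _ _).trans hr.le)
    have h2 : r ^ p = r ^ (p - 1) * r := by
      rw [← Real.rpow_add_one hr0.ne', sub_add_cancel]
    have h3 : 1 ≤ η * r ^ (p - 1) := by
      calc (1 : ℝ) = η * η⁻¹ := (mul_inv_cancel₀ hη.ne').symm
        _ ≤ _ := by gcongr
    rw [h2, ← mul_assoc]
    exact le_mul_of_one_le_left hr0.le h3
  have hK : IsCompact (closedBall e R) := isCompact_closedBall e R
  obtain ⟨t, -, ht, hcov⟩ := hK.finite_cover_balls hη
  obtain ⟨n, x, rfl⟩ : ∃ (n : ℕ) (x : Fin n → Z), range x = t := by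
    obtain ⟨n, x, -, hx⟩ := ht.fin_param
    exact ⟨n, x, hx⟩
  obtain ⟨φ, hφ⟩ := PartitionOfUnity.exists_isSubordinate (s := closedBall e R)
    isClosed_closedBall (fun i => ball (x i) η) (fun i => isOpen_ball) (by simpa using hcov)
  have hle : ∀ z, ∑ i, φ i z ≤ 1 := fun z => by
    simpa [finsum_eq_sum_of_fintype] using φ.sum_le_one z
  refine ⟨n, x, fun i => BoundedContinuousFunction.ofNormedAddCommGroup (φ i)
    (φ i).continuous 1 (fun z => ?_), ?_⟩
  · rw [Real.norm_eq_abs, abs_of_nonneg (φ.nonneg i z)]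
    exact φ.le_one i z
  rintro f ⟨hf0, hf⟩ z
  have hfd : ∀ z w, |f z - f w| ≤ dist z w := fun z w => by
    simpa [Real.dist_eq] using hf.dist_le_mul z w
  simp only [BoundedContinuousFunction.coe_ofNormedAddCommGroup]
  -- the first term vanishes on the large ball, the second is an average of values at most `η`
  have hdec : f z - ∑ i, f (x i) * φ i z =
      f z * (1 - ∑ i, φ i z) + ∑ i, φ i z * (f z - f (x i)) := by
    simp only [mul_sub, mul_one, Finset.mul_sum, Finset.sum_sub_distrib]
    simp only [mul_comm]
    ring
  have h1 : |f z * (1 - ∑ i, φ i z)| ≤ η * dist z e ^ p := by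
    by_cases hz : z ∈ closedBall e R
    · have := φ.sum_eq_one hz
      rw [finsum_eq_sum_of_fintype] at this
      rw [this, sub_self, mul_zero, abs_zero]
      positivity
    · rw [mem_closedBall, not_le] at hz
      have hnn : 0 ≤ ∑ i, φ i z := Finset.sum_nonneg fun i _ => φ.nonneg i z
      calc |f z * (1 - ∑ i, φ i z)| = |f z| * (1 - ∑ i, φ i z) := by
            rw [abs_mul, abs_of_nonneg (sub_nonneg.2 (hle z))]
        _ ≤ |f z| := mul_le_of_le_one_right (abs_nonneg _) (by linarith)
        _ ≤ dist z e := by simpa [hf0] using hfd z e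
        _ ≤ _ := hR _ hz
  have h2 : |∑ i, φ i z * (f z - f (x i))| ≤ η := by
    calc |∑ i, φ i z * (f z - f (x i))| ≤ ∑ i, |φ i z * (f z - f (x i))| :=
          Finset.abs_sum_le_sum_abs _ _
      _ ≤ ∑ i, φ i z * η := by
          refine Finset.sum_le_sum fun i _ => ?_
          rw [abs_mul, abs_of_nonneg (φ.nonneg i z)]
          by_cases hz : φ i z = 0
          · simp [hz]
          · have : z ∈ ball (x i) η := hφ i (subset_tsupport _ hz)
            exact mul_le_mul_of_nonneg_left ((hfd _ _).trans (mem_ball.1 this).le)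
              (φ.nonneg i z)
      _ = (∑ i, φ i z) * η := by rw [Finset.sum_mul]
      _ ≤ η := mul_le_of_le_one_left hη.le (hle z)
  rw [hdec]
  linarith [abs_add_le (f z * (1 - ∑ i, φ i z)) (∑ i, φ i z * (f z - f (x i)))]

/-! ### Moment bounds for pairs of positive measures -/

theorem dist_rpow_one_le {Z : Type*} [MetricSpace Z] {e : Z} {p : ℝ} (hp : 1 < p)
    (z : Z) : dist z e ^ (1 : ℝ) ≤ 1 + dist z e ^ p := by
  have h0 : 0 ≤ dist z e ^ p := by positivity
  rw [Real.rpow_one]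
  rcases le_total (dist z e) 1 with h | h
  · linarith
  · linarith [Real.self_le_rpow_of_one_le h hp.le]

theorem continuous_one_add_dist_rpow {Z : Type*} [MetricSpace Z] {e : Z} {p : ℝ}
    (hp : 1 < p) : Continuous fun z : Z => 1 + dist z e ^ p :=
  continuous_const.add ((continuous_id.dist continuous_const).rpow_const fun _ =>
    Or.inr (by linarith))

section

variable {Z : Type*} [MetricSpace Z] [MeasurableSpace Z] {e : Z} {p : ℝ}

theorem momentBall_subset_momentMeasures (hp : 1 < p) :
    momentBall e p ⊆ (momentMeasures e 1 : Set (SignedMeasure Z)) := by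
  intro μ (hμ : ∫⁻ z, ENNReal.ofReal (1 + dist z e ^ p) ∂μ.variation ≤ 1)
  refine (lintegral_mono fun z => ?_).trans_lt (hμ.trans_lt ENNReal.one_lt_top)
  exact ENNReal.ofReal_le_ofReal (dist_rpow_one_le hp z)

theorem abs_integral_le_of_mem_momentBall {μ : SignedMeasure Z}
    (hμ : μ ∈ momentBall e p) {h : Z → ℝ} {η : ℝ} (hη : 0 ≤ η)
    (hh : ∀ z, |h z| ≤ η * (1 + dist z e ^ p)) : |∫ᵛ z, h z ∂•μ| ≤ η := by
  have h1 := VectorMeasure.norm_integral_le_lintegral_norm (μ := μ) (f := h)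
    (B := (ContinuousLinearMap.lsmul ℝ ℝ : ℝ →L[ℝ] ℝ →L[ℝ] ℝ))
  have h2 : ∫⁻ z, ENNReal.ofReal ‖h z‖ ∂μ.variation ≤ ENNReal.ofReal η := by
    calc ∫⁻ z, ENNReal.ofReal ‖h z‖ ∂μ.variation
        ≤ ∫⁻ z, ENNReal.ofReal η * ENNReal.ofReal (1 + dist z e ^ p) ∂μ.variation := by
          refine lintegral_mono fun z => ?_
          rw [← ENNReal.ofReal_mul hη]
          exact ENNReal.ofReal_le_ofReal (hh z)
      _ = ENNReal.ofReal η * ∫⁻ z, ENNReal.ofReal (1 + dist z e ^ p) ∂μ.variation :=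
          lintegral_const_mul' _ _ ENNReal.ofReal_ne_top
      _ ≤ ENNReal.ofReal η * 1 := by gcongr; exact hμ
      _ = ENNReal.ofReal η := mul_one _
  have h3 := ENNReal.toReal_le_of_le_ofReal hη h2
  rw [ContinuousLinearMap.opNorm_lsmul, one_mul] at h1
  exact h1.trans h3

variable (e p) in
/-- Pairs of positive finite measures whose sum has `(1 + dist · e ^ p)`-moment at most `1`. -/
def momentPairs : Set (FiniteMeasure Z × FiniteMeasure Z) :=
  {ν | ∫⁻ z, ENNReal.ofReal (1 + dist z e ^ p) ∂((ν.1 : Measure Z) + (ν.2 : Measure Z)) ≤ 1}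

theorem toSignedMeasure_sub_mem_momentBall {ν : FiniteMeasure Z × FiniteMeasure Z}
    (hν : ν ∈ momentPairs e p) :
    (ν.1 : Measure Z).toSignedMeasure - (ν.2 : Measure Z).toSignedMeasure ∈ momentBall e p := by
  refine (lintegral_mono' ?_ le_rfl).trans hν
  refine VectorMeasure.variation_sub_le.trans ?_
  rw [Measure.variation_toSignedMeasure, Measure.variation_toSignedMeasure]

variable (e p) in
/-- The difference `ν₁ - ν₂` of a pair in `momentPairs e p`, as an element of `𝓜_1(Z)`. -/
noncomputable def momentPairs.diff (hp : 1 < p) (ν : momentPairs (Z := Z) e p) : M1 e :=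
  ⟨(ν.1.1 : Measure Z).toSignedMeasure - (ν.1.2 : Measure Z).toSignedMeasure,
    momentBall_subset_momentMeasures hp (toSignedMeasure_sub_mem_momentBall ν.2)⟩

theorem momentPairs.toSigned_diff (hp : 1 < p) (ν : momentPairs (Z := Z) e p) :
    (momentPairs.diff e p hp ν).toSigned =
      (ν.1.1 : Measure Z).toSignedMeasure - (ν.1.2 : Measure Z).toSignedMeasure := rfl

theorem momentPairs.toSigned_diff_mem (hp : 1 < p) (ν : momentPairs (Z := Z) e p) :
    (momentPairs.diff e p hp ν).toSigned ∈ momentBall e p :=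
  toSignedMeasure_sub_mem_momentBall ν.2

/-- Every element of the moment ball is the difference of its positive and negative parts. -/
theorem momentPairs.range_diff (hp : 1 < p) :
    range (momentPairs.diff (Z := Z) e p hp) = {μ | μ.toSigned ∈ momentBall e p} := by
  refine Subset.antisymm ?_ fun μ hμ => ?_
  · rintro _ ⟨ν, rfl⟩
    exact momentPairs.toSigned_diff_mem hp ν
  · set j := μ.toSigned.toJordanDecomposition
    have := j.posPart_finite
    have := j.negPart_finite
    refine ⟨⟨(⟨j.posPart, inferInstance⟩, ⟨j.negPart, inferInstance⟩), ?_⟩, ?_⟩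
    · have h : ∫⁻ z, ENNReal.ofReal (1 + dist z e ^ p) ∂μ.toSigned.variation ≤ 1 := hμ
      rw [← SignedMeasure.totalVariation_eq_variation] at h
      exact h
    · apply M1.toSigned_injective
      exact μ.toSigned.toSignedMeasure_toJordanDecomposition

variable [BorelSpace Z]

/-- The weight `1 + dist z e ^ p` is the supremum of its truncations, which are bounded and
continuous, so that its integral is a lower semicontinuous function of the measure. -/
theorem isClosed_momentPairs (hp : 1 < p) : IsClosed (momentPairs e p) := by
  let w : ℕ → Z →ᵇ ℝ≥0 := fun n => BoundedContinuousFunction.mkOfBound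
    ⟨fun z => min (1 + dist z e ^ p).toNNReal n, by
      have := continuous_one_add_dist_rpow (e := e) hp
      fun_prop⟩ n (fun x y => by
        rw [NNReal.dist_eq, abs_le]
        simp only [ContinuousMap.coe_mk]
        have h1 : ((min (1 + dist x e ^ p).toNNReal n : ℝ≥0) : ℝ) ≤ n :=
          NNReal.coe_le_coe.2 (min_le_right _ _)
        have h2 : ((min (1 + dist y e ^ p).toNNReal n : ℝ≥0) : ℝ) ≤ n :=
          NNReal.coe_le_coe.2 (min_le_right _ _)
        constructor
        · linarith [NNReal.coe_nonneg (min (1 + dist x e ^ p).toNNReal n)]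
        · linarith [NNReal.coe_nonneg (min (1 + dist y e ^ p).toNNReal n)])
  have hsup : ∀ z, ⨆ n, (w n z : ℝ≥0∞) = ENNReal.ofReal (1 + dist z e ^ p) := by
    intro z
    refine le_antisymm (iSup_le fun n => ENNReal.coe_le_coe.2 (min_le_left _ _)) ?_
    obtain ⟨n, hn⟩ := exists_nat_ge (1 + dist z e ^ p).toNNReal
    exact le_iSup_of_le n (ENNReal.coe_le_coe.2 (le_min le_rfl hn))
  have hset : momentPairs e p = ⋂ n, {ν : FiniteMeasure Z × FiniteMeasure Z |
      ν.1.testAgainstNN (w n) + ν.2.testAgainstNN (w n) ≤ 1} := by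
    ext ν
    simp only [momentPairs, mem_ofPred_eq, mem_iInter, ← hsup]
    rw [lintegral_iSup (fun n => (w n).continuous.measurable.coe_nnreal_ennreal)
      (fun m n hmn z => ENNReal.coe_le_coe.2 (min_le_min le_rfl (by exact_mod_cast hmn))),
      iSup_le_iff]
    refine forall_congr' fun n => ?_
    rw [lintegral_add_measure, ← FiniteMeasure.testAgainstNN_coe_eq,
      ← FiniteMeasure.testAgainstNN_coe_eq]
    norm_cast
  rw [hset]
  refine isClosed_iInter fun n => isClosed_le ?_ continuous_const
  exact ((FiniteMeasure.continuous_testAgainstNN_eval (w n)).comp continuous_fst).add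
    ((FiniteMeasure.continuous_testAgainstNN_eval (w n)).comp continuous_snd)

/-- Moments bound the mass far away from `e` by Markov's inequality, so that Prokhorov's theorem
applies to both components. -/
theorem isCompact_momentPairs [ProperSpace Z] (hp : 1 < p) : IsCompact (momentPairs e p) := by
  set u : ℕ → ℝ≥0 := fun n => (1 + (n : ℝ≥0) ^ p)⁻¹
  have hu : Tendsto u atTop (𝓝 0) := by
    refine tendsto_inv_atTop_zero.comp ?_
    refine tendsto_atTop_mono (fun n => le_add_self) ?_
    exact (NNReal.tendsto_rpow_atTop (by linarith)).comp tendsto_natCast_atTop_atTop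
  have hS := isCompact_setOfPred_finiteMeasure_mass_le_compl_isCompact_le (E := Z) 1 hu
    (K := fun n => closedBall e n) (fun n => isCompact_closedBall e n) (Or.inl inferInstance)
  refine (hS.prod hS).of_isClosed_subset (isClosed_momentPairs hp) ?_
  have key : ∀ ν : FiniteMeasure Z, ∫⁻ z, ENNReal.ofReal (1 + dist z e ^ p) ∂(ν : Measure Z) ≤ 1 →
      ν.mass ≤ 1 ∧ ∀ n : ℕ, ν (closedBall e n)ᶜ ≤ u n := by
    intro ν hν
    have hw : Measurable fun z => ENNReal.ofReal (1 + dist z e ^ p) :=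
      (continuous_one_add_dist_rpow hp).measurable.ennreal_ofReal
    constructor
    · rw [← ENNReal.coe_le_coe, FiniteMeasure.ennreal_mass, ← lintegral_one]
      refine (lintegral_mono fun z => ?_).trans hν
      rw [← ENNReal.ofReal_one]
      exact ENNReal.ofReal_le_ofReal (le_add_of_nonneg_right (by positivity))
    · intro n
      have h1 := mul_meas_ge_le_lintegral₀ (μ := (ν : Measure Z)) hw.aemeasurable
        (((1 + (n : ℝ≥0) ^ p : ℝ≥0)) : ℝ≥0∞)
      have h2 : (closedBall e n)ᶜ ⊆ {z | ((1 + (n : ℝ≥0) ^ p : ℝ≥0) : ℝ≥0∞) ≤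
          ENNReal.ofReal (1 + dist z e ^ p)} := by
        intro z hz
        rw [mem_compl_iff, mem_closedBall, not_le] at hz
        rw [mem_ofPred_eq, ← ENNReal.ofReal_coe_nnreal]
        refine ENNReal.ofReal_le_ofReal ?_
        push_cast
        gcongr
      have h3 : (((1 + (n : ℝ≥0) ^ p) * ν (closedBall e n)ᶜ : ℝ≥0) : ℝ≥0∞) ≤ 1 := by
        rw [ENNReal.coe_mul, FiniteMeasure.ennreal_coeFn_eq_coeFn_toMeasure]
        exact (mul_le_mul_right (measure_mono h2) _).trans (h1.trans hν)
      have h4 : (1 + (n : ℝ≥0) ^ p) * ν (closedBall e n)ᶜ ≤ 1 := by exact_mod_cast h3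
      simp only [u]
      rw [← one_div, le_div_iff₀ (by positivity), mul_comm]
      exact h4
  intro ν hν
  rw [momentPairs, mem_ofPred_eq, lintegral_add_measure] at hν
  exact ⟨key _ (le_self_add.trans hν), key _ (le_add_self.trans hν)⟩

/-! ### Continuity from the weak topology to the Kantorovich–Rubinstein norm -/

theorem integral_toSignedMeasure_sub {μ ν : Measure Z} [IsFiniteMeasure μ] [IsFiniteMeasure ν]
    (g : Z →ᵇ ℝ) :
    ∫ᵛ z, g z ∂•(μ.toSignedMeasure - ν.toSignedMeasure) = ∫ z, g z ∂μ - ∫ z, g z ∂ν := by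
  -- the integral against a positive measure is stated for the flipped bilinear map
  have hflip : (ContinuousLinearMap.lsmul ℝ ℝ : ℝ →L[ℝ] ℝ →L[ℝ] ℝ) =
      (ContinuousLinearMap.lsmul ℝ ℝ : ℝ →L[ℝ] ℝ →L[ℝ] ℝ).flip := by
    ext
    simp
  rw [VectorMeasure.integral_sub_vectorMeasure, hflip, VectorMeasure.integral_toSignedMeasure,
    VectorMeasure.integral_toSignedMeasure]
  · rw [VectorMeasure.Integrable, Measure.variation_toSignedMeasure]
    exact g.integrable μ
  · rw [VectorMeasure.Integrable, Measure.variation_toSignedMeasure]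
    exact g.integrable ν

/-- On measures in the moment ball, the Kantorovich–Rubinstein norm of a difference is controlled,
up to an arbitrarily small error, by the masses and the integrals of finitely many bounded
continuous functions. -/
theorem exists_norm_sub_le [ProperSpace Z] (e : Z) (hp : 1 < p) {η : ℝ} (hη : 0 < η) :
    ∃ (n : ℕ) (x : Fin n → Z) (g : Fin n → Z →ᵇ ℝ), ∀ μ ν : M1 e,
      μ.toSigned ∈ momentBall e p → ν.toSigned ∈ momentBall e p →
      ‖μ - ν‖ ≤ |μ.toSigned univ - ν.toSigned univ| + (2 * η + ∑ i, dist (x i) e *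
        |∫ᵛ z, g i z ∂•μ.toSigned - ∫ᵛ z, g i z ∂•ν.toSigned|) := by
  obtain ⟨n, x, g, hg⟩ := exists_finite_approx e hp hη
  refine ⟨n, x, g, fun μ ν hμ hν => ?_⟩
  have hgi : ∀ (κ : M1 e) i, κ.toSigned.Integrable (g i) := fun κ i =>
    (g i).integrable κ.toSigned.variation
  have happ : ∀ κ : M1 e, κ.toSigned ∈ momentBall e p → ∀ f ∈ lipUnitBall e,
      |∫ᵛ z, f z ∂•κ.toSigned - ∑ i, f (x i) * ∫ᵛ z, g i z ∂•κ.toSigned| ≤ η := by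
    intro κ hκ f hf
    have hi : ∀ i, κ.toSigned.Integrable (fun z => f (x i) * g i z) := fun i =>
      (hgi κ i).const_mul (f (x i))
    have h := abs_integral_le_of_mem_momentBall hκ hη.le (hg f hf)
    rw [VectorMeasure.integral_fun_sub (integrable_lip κ hf.2)
      (VectorMeasure.Integrable.fun_finsetSum _ fun i _ => hi i),
      VectorMeasure.integral_finsetSum _ fun i _ => hi i] at h
    convert h using 5 with i
    exact (VectorMeasure.integral_fun_smul _ _ (f (x i)) _).symm
  rw [M1.norm_def, normKRu, map_sub]
  refine add_le_add le_rfl (csSup_le ⟨_, _, zero_mem_lipUnitBall, rfl⟩ ?_)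
  rintro _ ⟨f, hf, rfl⟩
  dsimp only
  rw [VectorMeasure.integral_sub_vectorMeasure (integrable_lip μ hf.2) (integrable_lip ν hf.2)]
  have h1 := abs_le.1 (happ μ hμ f hf)
  have h2 := abs_le.1 (happ ν hν f hf)
  have h3 : ∑ i, f (x i) * ∫ᵛ z, g i z ∂•μ.toSigned - ∑ i, f (x i) * ∫ᵛ z, g i z ∂•ν.toSigned ≤
      ∑ i, dist (x i) e * |∫ᵛ z, g i z ∂•μ.toSigned - ∫ᵛ z, g i z ∂•ν.toSigned| := by
    rw [← Finset.sum_sub_distrib]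
    refine Finset.sum_le_sum fun i _ => ?_
    rw [← mul_sub]
    refine (le_abs_self _).trans ?_
    rw [abs_mul]
    gcongr
    simpa [Real.dist_eq, hf.1] using hf.2.dist_le_mul (x i) e
  linarith [h1.2, h2.1]

theorem momentPairs.continuous_integral_diff (hp : 1 < p) (g : Z →ᵇ ℝ) :
    Continuous fun ν : momentPairs (Z := Z) e p =>
      ∫ᵛ z, g z ∂•(momentPairs.diff e p hp ν).toSigned := by
  simp only [momentPairs.toSigned_diff, integral_toSignedMeasure_sub]
  have h := FiniteMeasure.continuous_integral_boundedContinuousFunction g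
  exact (h.comp (continuous_fst.comp continuous_subtype_val)).sub
    (h.comp (continuous_snd.comp continuous_subtype_val))

theorem momentPairs.continuous_diff_apply_univ (hp : 1 < p) :
    Continuous fun ν : momentPairs (Z := Z) e p =>
      (momentPairs.diff e p hp ν).toSigned univ := by
  -- the total mass is the integral of the constant function `1`
  convert momentPairs.continuous_integral_diff hp (BoundedContinuousFunction.const Z 1) using 2
  simp

theorem momentPairs.continuous_diff [ProperSpace Z] (hp : 1 < p) :
    Continuous (momentPairs.diff (Z := Z) e p hp) := by
  refine continuous_iff_continuousAt.2 fun ν₀ => ?_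
  rw [ContinuousAt, tendsto_iff_norm_sub_tendsto_zero, Metric.tendsto_nhds]
  intro ε hε
  obtain ⟨n, x, g, hxg⟩ := exists_norm_sub_le e hp (η := ε / 4) (by linarith)
  have h1 := ((momentPairs.continuous_diff_apply_univ hp).tendsto ν₀).sub_const
    ((momentPairs.diff e p hp ν₀).toSigned univ)
  have h2 := fun i => ((momentPairs.continuous_integral_diff hp (g i)).tendsto ν₀).sub_const
    (∫ᵛ z, g i z ∂•(momentPairs.diff e p hp ν₀).toSigned)
  have h3 := h1.abs.add ((tendsto_finsetSum Finset.univ fun i _ =>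
    (h2 i).abs.const_mul (dist (x i) e)).const_add (2 * (ε / 4)))
  simp only [sub_self, abs_zero, mul_zero, Finset.sum_const_zero, zero_add, add_zero] at h3
  filter_upwards [h3.eventually_lt_const (show 2 * (ε / 4) < ε by linarith)] with ν hν
  rw [Real.dist_eq, sub_zero, abs_of_nonneg (norm_nonneg _)]
  exact (hxg _ _ (momentPairs.toSigned_diff_mem hp ν)
    (momentPairs.toSigned_diff_mem hp ν₀)).trans_lt hν

theorem isCompact_setOf_toSigned_mem_momentBall [ProperSpace Z] (e : Z) (hp : 1 < p) :
    IsCompact {μ : M1 e | μ.toSigned ∈ momentBall e p} := by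
  have : CompactSpace (momentPairs (Z := Z) e p) :=
    isCompact_iff_compactSpace.1 (isCompact_momentPairs hp)
  rw [← momentPairs.range_diff hp]
  exact isCompact_range (momentPairs.continuous_diff hp)

end

end KantorovichRubinstein

theorem mainTheorem1 {Z : Type*} [MetricSpace Z] [MeasurableSpace Z] [BorelSpace Z]
    [LocallyCompactSpace Z] [CompleteSpace Z] [TopologicalSpace.SeparableSpace Z]
    (hZ : KantorovichRubinstein.IsGeodesicSpace Z) (e : Z) (p : ℝ) (hp : 1 < p) :
    KantorovichRubinstein.momentBall e p ⊆ KantorovichRubinstein.momentMeasures e 1 ∧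
    IsCompact {x : KantorovichRubinstein.KRu e | ∃ μ : KantorovichRubinstein.M1 e,
      μ.toSigned ∈ KantorovichRubinstein.momentBall e p ∧
      (μ : KantorovichRubinstein.KRu e) = x} := by
  have := hZ.properSpace
  exact ⟨KantorovichRubinstein.momentBall_subset_momentMeasures hp,
    (KantorovichRubinstein.isCompact_setOf_toSigned_mem_momentBall e hp).image
      (UniformSpace.Completion.continuous_coe _)⟩
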